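/- **Setting.** Let $d\ge 1$, $K,U\ge 0$, $M=K+U$. Let $\mathcal X\subset\mathbb R^d$ be compact and convex with $\|x\|\le 1$ for all $x\in\mathcal X$ (Euclidean norm). Let $\theta^*,a^1,\dots,a^M\in\mathbb R^d$ have norm at most $1$ and let $\alpha^1,\dots,\alpha^M\in\mathbb R$. The learner knows $\mathcal X$, all $\alpha^i$, and $a^i$ for $i\le K$. Let $\mathcal K=\{x\in\mathcal X:\langle a^i,x\rangle\le\alpha^i\ \forall i\le K\}$ and $\mathcal S=\{x\in\mathcal K:\langle a^i,x\rangle\le\alpha^i\ \forall i>K\}$. Assume that $\mathcal S\neq\emptyset$ and let $x^*\in\mathcal S$ maximise $\langle\theta^*,x\rangle$ over $\mathcal S$. In each round $t=1,2,\dots$ the learner plays $x_t\in\mathcal K$ and observes $r_t=\langle\theta^*,x_t\rangle+\gamma_t^0$ and $s_t^i=\langle a^i,x_t\rangle+\gamma_t^i$ for $1\le i\le M$. Fix a horizon $T$. Let $\mathcal F_t$ be the $\sigma$-algebra generated by $x_t$ and by all actions and observations of the rounds before $t$. For all $t\le T$ and $0\le i\le M$ the noise is conditionally centred and $1$-sub-Gaussian: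 $\mathbb E[\gamma_t^i\mid\mathcal F_t]=0$ and $\mathbb E[e^{\xi\gamma_t^i}\mid\mathcal F_t]\le e^{\xi^2/2}$ almost surely for every $\xi\in\mathbb R$. The noises need not be independent. **Algorithm DOSLB$(\lambda,\delta)$.** For $t\ge0$ put $V_t=\lambda I+\sum_{\tau\le t}x_\tau x_\tau^\top$, $\hat\theta_t=V_t^{-1}\sum_{\tau\le t}r_\tau x_\tau$, $\hat a^i_t=V_t^{-1}\sum_{\tau\le t}s^i_\tau x_\tau$, $\|z\|_V=\sqrt{\langle z,Vz\rangle}$, and $$\sqrt{\beta_t}=\sqrt{2\log\frac{(U+1)\det(V_t)^{1/2}\det(\lambda I)^{-1/2}}{\delta}}+\sqrt\lambda .$$ In round $t$ let $C_t^0=\{\theta:\|\theta-\hat\theta_{t-1}\|_{V_{t-1}}\le\sqrt{\beta_{t-1}}\}$; let $C_t^i=\{a^i\}$ for $i\le K$ and $C_t^i=\{a:\|a-\hat a^i_{t-1}\|_{V_{t-1}}\le\sqrt{\beta_{t-1}}\}$ for $K<i\le M$; and let $$\widetilde{\mathcal S}_t=\Big\{x\in\mathcal K:\min_{a\in C_t^i}\langle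 a,x\rangle\le\alpha^i\ \text{ for all }1\le i\le M\Big\}.$$ The algorithm picks $(x_t,\tilde\theta_t)\in\arg\max\{\langle\theta,x\rangle: x\in\widetilde{\mathcal S}_t,\ \theta\in C_t^0\}$, with ties broken arbitrarily; if $\widetilde{\mathcal S}_t=\emptyset$, it plays an arbitrary point of $\mathcal K$. **Regret.** $$\mathrm{Regret}_T=\sum_{t=1}^T\max\Big(\langle\theta^*,x^*-x_t\rangle,\ \max_{1\le i\le M}\big(\langle a^i,x_t\rangle-\alpha^i\big)_+\Big),$$ where the inner maximum is $0$ if $M=0$. **Theorem.** Let $\lambda\ge1$ and $\delta>0$. If the actions are chosen by DOSLB$(\lambda,\delta)$ in the rounds $1,\dots,T$, then with probability at least $1-\delta$ $$\mathrm{Regret}_T\le 4\sqrt{Td\log\Big(1+\frac{T}{\lambda d}\Big)}\left(\sqrt\lambda+\sqrt{\tfrac12\log\frac{U+1}{\delta}+\tfrac d4\log\Big(1+\frac{T}{\lambda d}\Big)}\right).$$ For fixed $\lambda$ the right-hand side is $\tilde O(d\sqrt T)$: there is a constant $C$ depending only on $\lambda$ such that it is at most $C\,d\sqrt T\,\big(1+\log(1+T)+\log\frac{U+1}{\delta}\big)$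 for all $d\ge1$, $U\ge 0$, $T\ge 0$ and $\delta\in(0,1)$. -/

import Mathlib

open MeasureTheory

/-- Actions and parameters live in `ℝ^d` with the Euclidean inner product. -/
abbrev Vec (d : ℕ) : Type := EuclideanSpace ℝ (Fin d)

/-- A linear bandit instance with linear safety constraints: a compact convex set `X`, an objective
vector `θ`, and constraints `⟪a i, x⟫ ≤ α i`, of which the `K` ones with index `Sum.inl _` are known
to the learner and the `U` ones with index `Sum.inr _` have unknown constraint vector `a i`. -/
structure SafeBandit (d K U : ℕ) where
  X : Set (Vec d)
  isCompact_X : IsCompact X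
  convex_X : Convex ℝ X
  θ : Vec d
  a : Fin K ⊕ Fin U → Vec d
  α : Fin K ⊕ Fin U → ℝ

namespace SafeBandit

variable {d K U : ℕ}

/-- The known domain: points of `X` that satisfy the known constraints. -/
def knownDomain (B : SafeBandit d K U) : Set (Vec d) :=
  {x | x ∈ B.X ∧ ∀ i : Fin K, inner ℝ (B.a (Sum.inl i)) x ≤ B.α (Sum.inl i)}

/-- The feasible set: points of the known domain that satisfy the unknown constraints too. -/
def feasible (B : SafeBandit d K U) : Set (Vec d) :=
  {x | x ∈ B.knownDomain ∧ ∀ i : Fin U, inner ℝ (B.a (Sum.inr i)) x ≤ B.α (Sum.inr i)}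

/-- `xs` is an optimal feasible solution of the linear program. -/
def IsOptimal (B : SafeBandit d K U) (xs : Vec d) : Prop :=
  xs ∈ B.feasible ∧ ∀ x ∈ B.feasible, inner ℝ B.θ x ≤ inner ℝ B.θ xs

/-- `max_i (⟪a i, x⟫ - α i)_+`; it is `0` if there are no constraints at all. -/
noncomputable def violation (B : SafeBandit d K U) (x : Vec d) : ℝ :=
  ⨆ i, max (inner ℝ (B.a i) x - B.α i) 0

/-- The regret of the first `T` actions. Rounds are numbered `0, 1, …, T - 1`. -/
noncomputable def regret (B : SafeBandit d K U) (xs : Vec d) (x : ℕ → Vec d) (T : ℕ) : ℝ :=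
  ∑ t ∈ Finset.range T, max (inner ℝ B.θ (xs - x t)) (B.violation (x t))

end SafeBandit

/-- The regularised Gram matrix `λ I + ∑_{τ < t} x_τ x_τᵀ` of the actions before round `t`. -/
noncomputable def gram {d : ℕ} (lam : ℝ) (x : ℕ → Vec d) (t : ℕ) : Matrix (Fin d) (Fin d) ℝ :=
  lam • (1 : Matrix (Fin d) (Fin d) ℝ) +
    ∑ τ ∈ Finset.range t, Matrix.vecMulVec (x τ).ofLp (x τ).ofLp

/-- The norm `‖z‖_V = √⟪z, V z⟫`. -/
noncomputable def weightedNorm {d : ℕ} (V : Matrix (Fin d) (Fin d) ℝ) (z : Vec d) : ℝ :=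
  √(inner ℝ z (WithLp.toLp 2 (V.mulVec z.ofLp)))

/-- The regularised least squares estimate `(λ I + XᵀX)⁻¹ Xᵀ Y` from the actions `x τ` and the
scalar feedback `y τ` of the rounds `τ < t`. -/
noncomputable def ridge {d : ℕ} (lam : ℝ) (x : ℕ → Vec d) (y : ℕ → ℝ) (t : ℕ) : Vec d :=
  WithLp.toLp 2 ((gram lam x t)⁻¹.mulVec (∑ τ ∈ Finset.range t, y τ • (x τ).ofLp))

/-- The radius `√(2 log ((U + 1) det(V)^{1/2} det(λ I)^{-1/2} / δ)) + √λ` of the confidence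
ellipsoids in round `t`, where `V` is the regularised Gram matrix of the earlier actions. -/
noncomputable def confRadius {d : ℕ} (U : ℕ) (lam δ : ℝ) (x : ℕ → Vec d) (t : ℕ) : ℝ :=
  √(2 * Real.log (((U : ℝ) + 1) * (gram lam x t).det ^ (1 / 2 : ℝ) *
      (lam • (1 : Matrix (Fin d) (Fin d) ℝ)).det ^ (-(1 / 2) : ℝ) / δ)) + √lam

/-- The confidence ellipsoid in round `t` around the least squares estimate. -/
noncomputable def confEllipsoid {d : ℕ} (U : ℕ) (lam δ : ℝ) (x : ℕ → Vec d) (y : ℕ → ℝ) (t : ℕ) :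
    Set (Vec d) :=
  {v | weightedNorm (gram lam x t) (v - ridge lam x y t) ≤ confRadius U lam δ x t}

namespace SafeBandit

variable {d K U : ℕ}

/-- The confidence set for the `i`-th constraint vector in round `t`: a singleton for a known
constraint, an ellipsoid computed from the feedback `s i τ`, `τ < t`, for an unknown one. -/
noncomputable def confSet (B : SafeBandit d K U) (lam δ : ℝ) (x : ℕ → Vec d)
    (s : Fin K ⊕ Fin U → ℕ → ℝ) (t : ℕ) : Fin K ⊕ Fin U → Set (Vec d)
  | Sum.inl i => {B.a (Sum.inl i)}
  | Sum.inr i => confEllipsoid U lam δ x (s (Sum.inr i)) t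

/-- The optimistic permissible set in round `t`: points `z` of the known domain such that, for each
`i`, the minimum of `⟪v, z⟫` over `v` in the (compact) `i`-th confidence set is at most `α i`. -/
def permissible (B : SafeBandit d K U) (lam δ : ℝ) (x : ℕ → Vec d)
    (s : Fin K ⊕ Fin U → ℕ → ℝ) (t : ℕ) : Set (Vec d) :=
  {z | z ∈ B.knownDomain ∧ ∀ i, ∃ v ∈ B.confSet lam δ x s t i, inner ℝ v z ≤ B.α i}

/-- In round `t` of the play with actions `x`, rewards `r` and safety feedback `s`, the action `x t`
obeys the doubly optimistic rule: it lies in the known domain and, together with some `v` in the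
confidence ellipsoid for `θ`, it maximises `⟪v, z⟫` over `z` in the permissible set and `v` in that
ellipsoid. If the permissible set is empty (no maximiser exists then), the action is an arbitrary
point of the known domain. -/
def IsDOSLBStep (B : SafeBandit d K U) (lam δ : ℝ) (x : ℕ → Vec d) (r : ℕ → ℝ)
    (s : Fin K ⊕ Fin U → ℕ → ℝ) (t : ℕ) : Prop :=
  x t ∈ B.knownDomain ∧
    ((B.permissible lam δ x s t).Nonempty →
      x t ∈ B.permissible lam δ x s t ∧
        ∃ v ∈ confEllipsoid U lam δ x r t,
          ∀ z ∈ B.permissible lam δ x s t, ∀ w ∈ confEllipsoid U lam δ x r t,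
            inner ℝ w z ≤ inner ℝ v (x t))

end SafeBandit

/-- `η` is conditionally centred and conditionally `1`-sub-Gaussian given the σ-algebra `m`. -/
def CondOneSubGaussian {Ω : Type*} {mΩ : MeasurableSpace Ω} (P : Measure Ω)
    (m : MeasurableSpace Ω) (η : Ω → ℝ) : Prop :=
  Integrable η P ∧ P[η | m] =ᵐ[P] 0 ∧
    ∀ ξ : ℝ, Integrable (fun ω => Real.exp (ξ * η ω)) P ∧
      ∀ᵐ ω ∂P, (P[fun ω => Real.exp (ξ * η ω) | m]) ω ≤ Real.exp (ξ ^ 2 / 2)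

/-- The σ-algebra generated by the actions and all the feedback of the rounds before `t` and by the
action of round `t`. -/
abbrev infoSigma {Ω ι : Type*} {d : ℕ} (x : ℕ → Ω → Vec d) (r : ℕ → Ω → ℝ) (s : ι → ℕ → Ω → ℝ)
    (t : ℕ) : MeasurableSpace Ω :=
  (⨆ (τ : ℕ) (_ : τ < t),
    (MeasurableSpace.comap (x τ) inferInstance ⊔ MeasurableSpace.comap (r τ) inferInstance ⊔
      ⨆ i, MeasurableSpace.comap (s i τ) inferInstance)) ⊔
    MeasurableSpace.comap (x t) inferInstance

/-- The right-hand side of the regret bound. -/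
noncomputable def regretBound (d U T : ℕ) (lam δ : ℝ) : ℝ :=
  4 * √((T : ℝ) * d * Real.log (1 + T / (lam * d))) *
    (√lam + √(1 / 2 * Real.log (((U : ℝ) + 1) / δ) +
      (d : ℝ) / 4 * Real.log (1 + T / (lam * d))))

/-! ### Quadratic forms of `V` and `V⁻¹`, rank one updates, determinants -/

section QuadraticForms

open Matrix

variable {n : Type*} [Fintype n]

/-! Two facts combine: the ellipsoids hold the true vectors in all rounds with probability at least
`1 - δ`, and on that event optimism bounds the regret deterministically.

Confidence. With `S` the noise sum, the process `(det (λ I) / det V)^{1/2} exp (‖S‖²_{V⁻¹} / 2)`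
starts at `1` and is a supermartingale. By the rank one update formulas, its one-step ratio is a
scalar Gaussian average of `exp (ξ η - ξ² / 2)` with past-measurable mean and variance
(`mixture_succ`, `lintegral_exp_gaussian_mixture`), so no `d`-dimensional integral is needed.
Ville's inequality keeps it below `(U + 1) / δ` with failure probability at most `δ / (U + 1)`, and
a union bound covers the `U + 1` ellipsoids.

Regret. On the good event the optimum `xs` is permissible, so both the objective gap and the
violation in round `t` are at most twice the radius times `‖x_t‖_{V⁻¹}` (`instantaneous_regret_le`).
They are also at most `2`, so their square is at most a multiple of `log (1 + ‖x_t‖²_{V⁻¹})`. These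
logarithms telescope to a log-determinant, which the trace controls; Cauchy–Schwarz over the rounds
finishes. -/

theorem Matrix.IsHermitian.dotProduct_mulVec_symm {V : Matrix n n ℝ} (hV : V.IsHermitian)
    (a b : n → ℝ) : a ⬝ᵥ V *ᵥ b = b ⬝ᵥ V *ᵥ a := by
  have h : Vᵀ = V := by simpa [Matrix.IsHermitian, conjTranspose_eq_transpose_of_trivial] using hV
  rw [dotProduct_mulVec, dotProduct_comm, ← mulVec_transpose, h]

/-- The quadratic form of `V` at `a + t b` is a nonnegative quadratic in `t`, so its discriminant is
nonpositive. -/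
theorem Matrix.PosSemidef.sq_dotProduct_mulVec_le {V : Matrix n n ℝ} (hV : V.PosSemidef)
    (a b : n → ℝ) : (a ⬝ᵥ V *ᵥ b) ^ 2 ≤ (a ⬝ᵥ V *ᵥ a) * (b ⬝ᵥ V *ᵥ b) := by
  have key : ∀ t : ℝ,
      0 ≤ (b ⬝ᵥ V *ᵥ b) * (t * t) + 2 * (a ⬝ᵥ V *ᵥ b) * t + a ⬝ᵥ V *ᵥ a := by
    intro t
    have h := hV.dotProduct_mulVec_nonneg (a + t • b)
    have hs := hV.isHermitian.dotProduct_mulVec_symm b a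
    simp only [star_trivial, mulVec_add, mulVec_smul, dotProduct_add, add_dotProduct,
      dotProduct_smul, smul_dotProduct, smul_eq_mul] at h
    rw [hs] at h
    linarith
  have h := discrim_le_zero key
  rw [discrim] at h
  linarith

theorem Matrix.PosSemidef.sqrt_dotProduct_mulVec_add_le {V : Matrix n n ℝ} (hV : V.PosSemidef)
    (a b : n → ℝ) :
    √((a + b) ⬝ᵥ V *ᵥ (a + b)) ≤ √(a ⬝ᵥ V *ᵥ a) + √(b ⬝ᵥ V *ᵥ b) := by
  have ha : 0 ≤ a ⬝ᵥ V *ᵥ a := by simpa using hV.dotProduct_mulVec_nonneg a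
  have hb : 0 ≤ b ⬝ᵥ V *ᵥ b := by simpa using hV.dotProduct_mulVec_nonneg b
  have hab : a ⬝ᵥ V *ᵥ b ≤ √(a ⬝ᵥ V *ᵥ a) * √(b ⬝ᵥ V *ᵥ b) := by
    rw [← Real.sqrt_mul ha]
    exact Real.le_sqrt_of_sq_le (hV.sq_dotProduct_mulVec_le a b)
  refine Real.sqrt_le_iff.2 ⟨by positivity, ?_⟩
  have hs := hV.isHermitian.dotProduct_mulVec_symm b a
  simp only [mulVec_add, dotProduct_add, add_dotProduct]
  rw [hs]
  nlinarith [Real.sq_sqrt ha, Real.sq_sqrt hb]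

theorem vecMulVec_self_posSemidef (z : n → ℝ) : (vecMulVec z z).PosSemidef := by
  simpa using posSemidef_vecMulVec_self_star z

variable [DecidableEq n]

theorem Matrix.PosDef.mulVec_inv_mulVec {V : Matrix n n ℝ} (hV : V.PosDef) (z : n → ℝ) :
    V *ᵥ (V⁻¹ *ᵥ z) = z := by
  rw [mulVec_mulVec, mul_nonsing_inv _ hV.det_pos.ne'.isUnit, one_mulVec]

theorem Matrix.PosDef.inv_mulVec_mulVec {V : Matrix n n ℝ} (hV : V.PosDef) (z : n → ℝ) :
    V⁻¹ *ᵥ (V *ᵥ z) = z := by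
  rw [mulVec_mulVec, nonsing_inv_mul _ hV.det_pos.ne'.isUnit, one_mulVec]

theorem Matrix.PosDef.inv_quadratic_nonneg {V : Matrix n n ℝ} (hV : V.PosDef) (z : n → ℝ) :
    0 ≤ z ⬝ᵥ V⁻¹ *ᵥ z := by
  simpa using hV.inv.posSemidef.dotProduct_mulVec_nonneg z

theorem Matrix.PosDef.quadratic_inv_mulVec {V : Matrix n n ℝ} (hV : V.PosDef) (z : n → ℝ) :
    (V⁻¹ *ᵥ z) ⬝ᵥ V *ᵥ (V⁻¹ *ᵥ z) = z ⬝ᵥ V⁻¹ *ᵥ z := by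
  rw [hV.mulVec_inv_mulVec, dotProduct_comm]

/-- Cauchy–Schwarz for the dual pair of norms of `V` and `V⁻¹`. -/
theorem Matrix.PosDef.dotProduct_le_sqrt_mul_sqrt {V : Matrix n n ℝ} (hV : V.PosDef)
    (a z : n → ℝ) : a ⬝ᵥ z ≤ √(a ⬝ᵥ V *ᵥ a) * √(z ⬝ᵥ V⁻¹ *ᵥ z) := by
  have ha : 0 ≤ a ⬝ᵥ V *ᵥ a := by simpa using hV.posSemidef.dotProduct_mulVec_nonneg a
  rw [← Real.sqrt_mul ha]
  refine Real.le_sqrt_of_sq_le ?_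
  have h := hV.posSemidef.sq_dotProduct_mulVec_le a (V⁻¹ *ᵥ z)
  rwa [hV.quadratic_inv_mulVec, hV.mulVec_inv_mulVec] at h

theorem Matrix.PosDef.det_add_vecMulVec_self {V : Matrix n n ℝ} (hV : V.PosDef) (z : n → ℝ) :
    (V + vecMulVec z z).det = V.det * (1 + z ⬝ᵥ V⁻¹ *ᵥ z) := by
  rw [vecMulVec_eq Unit, det_add_replicateCol_mul_replicateRow hV.det_pos.ne'.isUnit]
  congr 1
  rw [det_unique, Matrix.add_apply, Matrix.one_apply_eq, Matrix.mul_assoc]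
  simp [Matrix.mul_apply, dotProduct, mulVec]

/-- Effect of a rank one update of `V` on the quadratic form of `V⁻¹`. -/
theorem Matrix.PosDef.inv_quadratic_rank_one_update {V : Matrix n n ℝ} (hV : V.PosDef)
    (S z : n → ℝ) (η : ℝ) :
    (S + η • z) ⬝ᵥ (V + vecMulVec z z)⁻¹ *ᵥ (S + η • z) =
      S ⬝ᵥ V⁻¹ *ᵥ S + (2 * η * (z ⬝ᵥ V⁻¹ *ᵥ S) + η ^ 2 * (z ⬝ᵥ V⁻¹ *ᵥ z)
        - (z ⬝ᵥ V⁻¹ *ᵥ S) ^ 2) / (1 + z ⬝ᵥ V⁻¹ *ᵥ z) := by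
  have hu := hV.inv_quadratic_nonneg z
  have hs := hV.inv.isHermitian.dotProduct_mulVec_symm S z
  set p := z ⬝ᵥ V⁻¹ *ᵥ S with hp
  set u := z ⬝ᵥ V⁻¹ *ᵥ z with hu'
  -- Sherman–Morrison coefficient: `V⁻¹ S + k V⁻¹ z` solves the updated system exactly when `k + p +
  -- k u = η`.
  set k := (η - p) / (1 + u) with hk
  have hV' : (V + vecMulVec z z).PosDef := hV.add_posSemidef (vecMulVec_self_posSemidef z)
  have hy : (V + vecMulVec z z)⁻¹ *ᵥ (S + η • z) = V⁻¹ *ᵥ S + k • V⁻¹ *ᵥ z := by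
    have h : (V + vecMulVec z z) *ᵥ (V⁻¹ *ᵥ S + k • V⁻¹ *ᵥ z) = S + η • z := by
      have hη : k + (p + k * u) = η := by
        rw [hk]; field_simp; ring
      rw [add_mulVec, mulVec_add, mulVec_add, mulVec_smul, mulVec_smul, hV.mulVec_inv_mulVec,
        hV.mulVec_inv_mulVec, vecMulVec_mulVec, vecMulVec_mulVec, ← hp, ← hu', ← hη]
      ext i
      simp
      ring
    rw [← h, hV'.inv_mulVec_mulVec]
  rw [hy]
  simp only [dotProduct_add, add_dotProduct, dotProduct_smul, smul_dotProduct, smul_eq_mul]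
  rw [← hp, ← hu', hs, hk]
  field_simp
  ring

/-- A lower bound `λ I ≤ V` gives `V⁻¹ ≤ λ⁻¹ I`. -/
theorem Matrix.PosDef.inv_quadratic_le {V : Matrix n n ℝ} (hV : V.PosDef) {lam : ℝ}
    (hlam : 0 < lam) (h : ∀ z : n → ℝ, lam * (z ⬝ᵥ z) ≤ z ⬝ᵥ V *ᵥ z) (z : n → ℝ) :
    lam * (z ⬝ᵥ V⁻¹ *ᵥ z) ≤ z ⬝ᵥ z := by
  have h1 := h (V⁻¹ *ᵥ z)
  rw [hV.quadratic_inv_mulVec] at h1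
  -- With `q` the form of `V⁻¹` at `z`, Euclidean Cauchy–Schwarz gives `q² ≤ |z|² |V⁻¹ z|²`, while
  -- `h1` says `λ |V⁻¹ z|² ≤ q`; one factor `q` cancels.
  have h2 := (PosSemidef.one (n := n) (R := ℝ)).sq_dotProduct_mulVec_le z (V⁻¹ *ᵥ z)
  simp only [one_mulVec] at h2
  have h3 := hV.inv_quadratic_nonneg z
  have h4 : 0 ≤ z ⬝ᵥ z := by simpa using dotProduct_star_self_nonneg z
  set q := z ⬝ᵥ V⁻¹ *ᵥ z
  rcases h3.eq_or_lt with h0 | h0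
  · rw [← h0]; simpa using h4
  · refine le_of_mul_le_mul_right ?_ h0
    nlinarith

/-- The determinant–trace inequality in logarithmic form. -/
theorem Matrix.PosDef.log_det_le {V : Matrix n n ℝ} (hV : V.PosDef) {c : ℝ} (hc : 0 < c)
    (htr : V.trace ≤ Fintype.card n * c) :
    Real.log V.det ≤ Fintype.card n * Real.log c := by
  have hdet := hV.isHermitian.det_eq_prod_eigenvalues
  have htrace := hV.isHermitian.trace_eq_sum_eigenvalues
  simp only [RCLike.ofReal_real_eq_id, id] at hdet htrace
  have hpos := hV.eigenvalues_pos
  rw [hdet, Real.log_prod (fun i _ => (hpos i).ne')]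
  -- Tangent line of the logarithm at `c`; the linear terms sum to `trace / c - n ≤ 0`.
  have h : ∀ i, Real.log (hV.isHermitian.eigenvalues i) ≤
      Real.log c + (hV.isHermitian.eigenvalues i / c - 1) := by
    intro i
    have := Real.log_le_sub_one_of_pos (div_pos (hpos i) hc)
    rw [Real.log_div (hpos i).ne' hc.ne'] at this
    linarith
  refine (Finset.sum_le_sum fun i _ => h i).trans ?_
  rw [Finset.sum_add_distrib, Finset.sum_sub_distrib, ← Finset.sum_div, ← htrace]
  simp only [Finset.sum_const, Finset.card_univ, nsmul_eq_mul, mul_one]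
  have : V.trace / c ≤ Fintype.card n := by rwa [div_le_iff₀ hc]
  linarith

end QuadraticForms

/-! ### The regularised Gram matrix and the ridge estimate -/

section Gram

open Matrix hiding gram

variable {d : ℕ} {lam : ℝ}

theorem gram_zero (lam : ℝ) (x : ℕ → Vec d) :
    gram lam x 0 = lam • (1 : Matrix (Fin d) (Fin d) ℝ) := by
  simp [gram]

theorem gram_succ (lam : ℝ) (x : ℕ → Vec d) (t : ℕ) :
    gram lam x (t + 1) = gram lam x t + vecMulVec (x t).ofLp (x t).ofLp := by
  simp [gram, Finset.sum_range_succ, add_assoc]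

theorem gram_posDef (hlam : 0 < lam) (x : ℕ → Vec d) (t : ℕ) : (gram lam x t).PosDef :=
  (PosDef.one.smul hlam).add_posSemidef
    (posSemidef_sum _ fun τ _ => vecMulVec_self_posSemidef (x τ).ofLp)

theorem det_smul_one (lam : ℝ) : (lam • (1 : Matrix (Fin d) (Fin d) ℝ)).det = lam ^ d := by
  simp

theorem le_quadratic_gram (lam : ℝ) (x : ℕ → Vec d) (t : ℕ) (z : Fin d → ℝ) :
    lam * (z ⬝ᵥ z) ≤ z ⬝ᵥ gram lam x t *ᵥ z := by
  have h := (posSemidef_sum (Finset.range t)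
    fun τ _ => vecMulVec_self_posSemidef (x τ).ofLp).dotProduct_mulVec_nonneg z
  simp only [star_trivial] at h
  rw [gram, add_mulVec, dotProduct_add, smul_mulVec, one_mulVec, dotProduct_smul, smul_eq_mul]
  linarith

theorem norm_sq_eq_dotProduct (z : Vec d) : ‖z‖ ^ 2 = z.ofLp ⬝ᵥ z.ofLp := by
  rw [EuclideanSpace.real_norm_sq_eq, dotProduct]
  simp [sq]

theorem trace_gram_le (x : ℕ → Vec d) (t : ℕ) (hx : ∀ τ < t, ‖x τ‖ ≤ 1) :
    (gram lam x t).trace ≤ lam * d + t := by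
  rw [gram, trace_add, trace_smul, trace_one, Fintype.card_fin, smul_eq_mul, trace_sum]
  gcongr
  calc ∑ τ ∈ Finset.range t, (vecMulVec (x τ).ofLp (x τ).ofLp).trace
      ≤ ∑ τ ∈ Finset.range t, (1 : ℝ) := by
        refine Finset.sum_le_sum fun τ hτ => ?_
        rw [trace_vecMulVec, ← norm_sq_eq_dotProduct]
        exact pow_le_one₀ (norm_nonneg _) (hx τ (Finset.mem_range.1 hτ))
    _ = t := by simp

theorem log_det_gram_le (hlam : 0 < lam) (x : ℕ → Vec d) (t : ℕ) (hx : ∀ τ < t, ‖x τ‖ ≤ 1) :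
    Real.log (gram lam x t).det - d * Real.log lam ≤ d * Real.log (1 + t / (lam * d)) := by
  rcases Nat.eq_zero_or_pos d with rfl | hd
  · simp
  have hd' : (0 : ℝ) < d := by exact_mod_cast hd
  have h := (gram_posDef hlam x t).log_det_le (c := lam * (1 + t / (lam * d))) (by positivity)
    ((trace_gram_le x t hx).trans_eq (by rw [Fintype.card_fin]; field_simp))
  rw [Fintype.card_fin, Real.log_mul hlam.ne' (by positivity)] at h
  linarith

/-- The elliptical potential identity. -/
theorem log_det_gram_eq_sum (hlam : 0 < lam) (x : ℕ → Vec d) (t : ℕ) :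
    Real.log (gram lam x t).det - d * Real.log lam =
      ∑ τ ∈ Finset.range t,
        Real.log (1 + (x τ).ofLp ⬝ᵥ (gram lam x τ)⁻¹ *ᵥ (x τ).ofLp) := by
  induction t with
  | zero => simp [gram_zero]
  | succ t ih =>
    have hV := gram_posDef hlam x t
    have hu := hV.inv_quadratic_nonneg (x t).ofLp
    rw [Finset.sum_range_succ, ← ih, gram_succ, hV.det_add_vecMulVec_self,
      Real.log_mul hV.det_pos.ne' (by positivity)]
    ring

theorem inner_eq_dotProduct (y z : Vec d) : inner ℝ y z = y.ofLp ⬝ᵥ z.ofLp := by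
  rw [EuclideanSpace.inner_eq_star_dotProduct, dotProduct_comm]
  simp

theorem weightedNorm_eq (V : Matrix (Fin d) (Fin d) ℝ) (z : Vec d) :
    weightedNorm V z = √(z.ofLp ⬝ᵥ V *ᵥ z.ofLp) := by
  rw [weightedNorm, inner_eq_dotProduct]

/-- The sum `∑_{τ < t} η_τ x_τ` of the actions weighted by the noise. -/
noncomputable def noiseSum (x : ℕ → Vec d) (η : ℕ → ℝ) (t : ℕ) : Fin d → ℝ :=
  ∑ τ ∈ Finset.range t, η τ • (x τ).ofLp

/-- Substituting `y = ⟪v, x⟫ + noise` into the normal equations gives `v - ridge = V⁻¹ (λ v - S)`.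
The triangle inequality separates noise from bias, and `V⁻¹ ≤ λ⁻¹ I` bounds the bias by `√λ`. -/
theorem weightedNorm_sub_ridge_le (hlam : 0 < lam) (x : ℕ → Vec d) (y : ℕ → ℝ) (v : Vec d)
    (hv : ‖v‖ ≤ 1) (t : ℕ) :
    weightedNorm (gram lam x t) (v - ridge lam x y t) ≤
      √(noiseSum x (fun τ => y τ - inner ℝ v (x τ)) t ⬝ᵥ
        (gram lam x t)⁻¹ *ᵥ noiseSum x (fun τ => y τ - inner ℝ v (x τ)) t) + √lam := by
  set S := noiseSum x (fun τ => y τ - inner ℝ v (x τ)) t with hS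
  have hV := gram_posDef hlam x t
  have hsum : ∑ τ ∈ Finset.range t, y τ • (x τ).ofLp =
      S + gram lam x t *ᵥ v.ofLp - lam • v.ofLp := by
    rw [gram, add_mulVec, smul_mulVec, one_mulVec, sum_mulVec, hS, noiseSum]
    simp only [vecMulVec_mulVec, inner_eq_dotProduct]
    rw [add_comm (lam • v.ofLp), ← add_assoc, add_sub_cancel_right, ← Finset.sum_add_distrib]
    refine Finset.sum_congr rfl fun τ _ => ?_
    ext i
    simp [dotProduct_comm v.ofLp]
    ring
  have hridge : (v - ridge lam x y t).ofLp =
      (gram lam x t)⁻¹ *ᵥ (-S) + (gram lam x t)⁻¹ *ᵥ (lam • v.ofLp) := by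
    rw [← mulVec_add, WithLp.ofLp_sub, ridge, hsum]
    simp only [mulVec_sub, mulVec_add, hV.inv_mulVec_mulVec, mulVec_neg]
    abel
  rw [weightedNorm_eq, hridge]
  refine (hV.posSemidef.sqrt_dotProduct_mulVec_add_le _ _).trans ?_
  rw [hV.quadratic_inv_mulVec, hV.quadratic_inv_mulVec]
  simp only [mulVec_neg, dotProduct_neg, neg_dotProduct, neg_neg]
  gcongr
  have h1 := hV.inv_quadratic_le hlam (le_quadratic_gram lam x t) v.ofLp
  rw [← norm_sq_eq_dotProduct] at h1
  have h2 : ‖v‖ ^ 2 ≤ 1 := pow_le_one₀ (norm_nonneg _) hv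
  simp only [mulVec_smul, dotProduct_smul, smul_dotProduct, smul_eq_mul]
  nlinarith

end Gram

/-! ### Exponential supermartingale steps and Ville's inequality -/

section SubGaussian

open ENNReal ProbabilityTheory

variable {Ω : Type*} {m mΩ : MeasurableSpace Ω} {P : Measure Ω}

/-- The weight `Z` may be infinite or non-integrable, so instead of pulling it out of a conditional
expectation one compares `P` and its reweighting by the exponential as measures on `m`. -/
theorem CondOneSubGaussian.lintegral_mul_exp_const_le [IsProbabilityMeasure P]
    (hm : m ≤ mΩ) {η : Ω → ℝ} (hη : CondOneSubGaussian P m η)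
    (hηm : Measurable η) (c : ℝ) {Z : Ω → ℝ≥0∞} (hZ : Measurable[m] Z) :
    ∫⁻ ω, Z ω * ENNReal.ofReal (Real.exp (c * η ω - c ^ 2 / 2)) ∂P ≤ ∫⁻ ω, Z ω ∂P := by
  obtain ⟨hint, hle⟩ := hη.2.2 c
  set f : Ω → ℝ≥0∞ := fun ω => ENNReal.ofReal (Real.exp (c * η ω - c ^ 2 / 2)) with hf
  have hfm : Measurable f := by fun_prop
  have hmeas : (P.withDensity f).trim hm ≤ P.trim hm := by
    refine Measure.le_iff.2 fun A hA => ?_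
    rw [trim_measurableSet_eq hm hA, trim_measurableSet_eq hm hA, withDensity_apply _ (hm A hA)]
    have hint' : Integrable (fun ω => Real.exp (c * η ω - c ^ 2 / 2)) P := by
      simp_rw [Real.exp_sub]
      exact hint.div_const _
    rw [hf, ← ofReal_integral_eq_lintegral_ofReal hint'.integrableOn
      (ae_of_all _ fun ω => (Real.exp_pos _).le)]
    refine ENNReal.ofReal_le_of_le_toReal ?_
    simp_rw [Real.exp_sub]
    rw [integral_div, div_le_iff₀ (Real.exp_pos _), ← setIntegral_condExp hm hint hA]
    calc ∫ ω in A, (P[fun ω => Real.exp (c * η ω) | m]) ω ∂P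
        ≤ ∫ _ in A, Real.exp (c ^ 2 / 2) ∂P :=
          integral_mono_ae integrable_condExp.integrableOn (integrable_const _)
            (ae_restrict_of_ae hle)
      _ = (P A).toReal * Real.exp (c ^ 2 / 2) := by
          simp [Measure.real]
  calc ∫⁻ ω, Z ω * f ω ∂P = ∫⁻ ω, Z ω ∂(P.withDensity f) := by
        rw [lintegral_withDensity_eq_lintegral_mul _ hfm (hZ.mono hm le_rfl)]
        simp [mul_comm]
    _ = ∫⁻ ω, Z ω ∂((P.withDensity f).trim hm) := (lintegral_trim hm hZ).symm
    _ ≤ ∫⁻ ω, Z ω ∂(P.trim hm) := lintegral_mono' hmeas le_rfl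
    _ = ∫⁻ ω, Z ω ∂P := lintegral_trim hm hZ

/-- For simple `ξ`, the fibres are `m`-measurable and the constant case applies on each, their
indicators being absorbed into `Z`. Fatou's lemma passes to general `ξ`. -/
theorem CondOneSubGaussian.lintegral_mul_exp_le [IsProbabilityMeasure P]
    (hm : m ≤ mΩ) {η : Ω → ℝ} (hη : CondOneSubGaussian P m η)
    (hηm : Measurable η) {ξ : Ω → ℝ} (hξ : Measurable[m] ξ) {Z : Ω → ℝ≥0∞}
    (hZ : Measurable[m] Z) :
    ∫⁻ ω, Z ω * ENNReal.ofReal (Real.exp (ξ ω * η ω - ξ ω ^ 2 / 2)) ∂P ≤ ∫⁻ ω, Z ω ∂P := by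
  let φ : ℕ → @SimpleFunc Ω m ℝ := fun k => @SimpleFunc.approxOn ℝ Ω _ _ _ m ξ hξ Set.univ 0
    (Set.mem_univ _) _ k
  have hφ : ∀ ω, Filter.Tendsto (fun k => φ k ω) Filter.atTop (nhds (ξ ω)) := fun ω =>
    @SimpleFunc.tendsto_approxOn ℝ Ω _ _ _ m ξ hξ Set.univ 0 (Set.mem_univ _) _ ω (by simp)
  have hφm : ∀ k, Measurable[m] (φ k) := fun k => @SimpleFunc.measurable Ω ℝ m _ (φ k)
  have hφm' : ∀ k, Measurable (φ k) := fun k => (hφm k).mono hm le_rfl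
  have hZ' : Measurable Z := hZ.mono hm le_rfl
  have hstep : ∀ k, ∫⁻ ω, Z ω * ENNReal.ofReal (Real.exp (φ k ω * η ω - φ k ω ^ 2 / 2)) ∂P
      ≤ ∫⁻ ω, Z ω ∂P := by
    intro k
    have hsplit : ∀ g : ℝ → Ω → ℝ≥0∞, ∀ ω, Z ω * g (φ k ω) ω =
        ∑ c ∈ @SimpleFunc.range Ω ℝ m (φ k), ((φ k) ⁻¹' {c}).indicator Z ω * g c ω := by
      intro g ω
      rw [Finset.sum_eq_single (φ k ω)]
      · simp
      · intro b _ hb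
        rw [Set.indicator_of_notMem (by simpa using hb.symm), zero_mul]
      · intro h
        exact absurd (@SimpleFunc.mem_range_self Ω ℝ m (φ k) ω) h
    have hfib : ∀ c, MeasurableSet[m] ((φ k) ⁻¹' {c}) := fun c => hφm k (measurableSet_singleton c)
    rw [lintegral_congr (hsplit fun c ω => ENNReal.ofReal (Real.exp (c * η ω - c ^ 2 / 2))),
      lintegral_finsetSum' _ fun c _ => ?_]
    swap
    · have := hZ'.indicator (hm _ (hfib c))
      fun_prop
    have h1 := lintegral_congr (μ := P) (hsplit fun _ _ => 1)
    simp only [mul_one] at h1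
    rw [h1, lintegral_finsetSum' _ fun c _ => (hZ'.indicator (hm _ (hfib c))).aemeasurable]
    exact Finset.sum_le_sum fun c _ =>
      hη.lintegral_mul_exp_const_le hm hηm c (hZ.indicator (hfib c))
  have hlim : ∀ ω, Z ω * ENNReal.ofReal (Real.exp (ξ ω * η ω - ξ ω ^ 2 / 2)) =
      Filter.liminf (fun k => Z ω * ENNReal.ofReal (Real.exp (φ k ω * η ω - φ k ω ^ 2 / 2)))
        Filter.atTop := by
    intro ω
    refine (Filter.Tendsto.liminf_eq ?_).symm
    refine ENNReal.Tendsto.const_mul ?_ (Or.inl ?_)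
    · refine (ENNReal.continuous_ofReal.tendsto _).comp ((Real.continuous_exp.tendsto _).comp ?_)
      exact ((hφ ω).mul_const _).sub (((hφ ω).pow 2).div_const 2)
    · exact (ENNReal.ofReal_pos.2 (Real.exp_pos _)).ne'
  rw [lintegral_congr hlim]
  refine (lintegral_liminf_le fun k => ?_).trans ?_
  · have := hφm' k
    fun_prop
  · exact Filter.liminf_le_of_frequently_le' (Filter.Frequently.of_forall hstep)

/-- The Gaussian mixture over `ξ ∼ N(p, u)` of the exponential `exp (ξ y - ξ² / 2)`. -/
theorem lintegral_exp_gaussian_mixture (p y : ℝ) {u : ℝ} (hu : 0 ≤ u) :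
    ∫⁻ g, ENNReal.ofReal (Real.exp ((p + √u * g) * y - (p + √u * g) ^ 2 / 2))
        ∂(gaussianReal 0 1) =
      ENNReal.ofReal ((√(1 + u))⁻¹ *
        Real.exp ((2 * y * p + y ^ 2 * u - p ^ 2) / (1 + u) / 2)) := by
  have h1u : 0 < 1 + u := by positivity
  have hv : Real.toNNReal (1 + u)⁻¹ ≠ 0 := by
    simpa using inv_pos.2 h1u
  rw [gaussianReal_of_var_ne_zero _ one_ne_zero, lintegral_withDensity_eq_lintegral_mul _
    (measurable_gaussianPDF _ _) (by fun_prop)]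
  -- Completing the square leaves a Gaussian density of mean `√u (y - p) / (1 + u)` and variance `1
  -- / (1 + u)`; its total mass `1` is inserted so that the integrands can be compared pointwise.
  rw [← mul_one (ENNReal.ofReal (_ * _)),
    ← lintegral_gaussianPDF_eq_one (√u * (y - p) / (1 + u)) hv,
    ← lintegral_const_mul _ (measurable_gaussianPDF _ _)]
  refine lintegral_congr fun g => ?_
  simp only [Pi.mul_apply, gaussianPDF]
  rw [← ENNReal.ofReal_mul (gaussianPDFReal_nonneg _ _ _), ← ENNReal.ofReal_mul (by positivity)]
  congr 1
  simp only [gaussianPDFReal, NNReal.coe_one, Real.coe_toNNReal _ (inv_pos.2 h1u).le, mul_one,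
    sub_zero]
  have hsq : √(2 * Real.pi * (1 + u)⁻¹) = √(2 * Real.pi) * (√(1 + u))⁻¹ := by
    rw [Real.sqrt_mul (by positivity), Real.sqrt_inv]
  have hexp : Real.exp (-g ^ 2 / 2) *
        Real.exp ((p + √u * g) * y - (p + √u * g) ^ 2 / 2) =
      Real.exp ((2 * y * p + y ^ 2 * u - p ^ 2) / (1 + u) / 2) *
        Real.exp (-(g - √u * (y - p) / (1 + u)) ^ 2 / (2 * (1 + u)⁻¹)) := by
    rw [← Real.exp_add, ← Real.exp_add]
    congr 1
    have hs := Real.sq_sqrt hu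
    generalize √u = w at hs
    subst hs
    field_simp
    ring
  have hne : √(1 + u) ≠ 0 := (Real.sqrt_pos.2 h1u).ne'
  have hpi : √(2 * Real.pi) ≠ 0 := (Real.sqrt_pos.2 (by positivity)).ne'
  rw [hsq, mul_assoc, hexp]
  field_simp

/-- By Tonelli the Gaussian average is taken last; for each fixed `g` the exponent parameter `p + √u
g` is `m`-measurable. -/
theorem CondOneSubGaussian.lintegral_mul_mixture_le [IsProbabilityMeasure P]
    (hm : m ≤ mΩ) {η : Ω → ℝ} (hη : CondOneSubGaussian P m η)
    (hηm : Measurable η) {p u : Ω → ℝ} (hp : Measurable[m] p) (hu : Measurable[m] u)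
    (hu0 : ∀ ω, 0 ≤ u ω) {Z : Ω → ℝ≥0∞} (hZ : Measurable[m] Z) :
    ∫⁻ ω, Z ω * ENNReal.ofReal ((√(1 + u ω))⁻¹ *
        Real.exp ((2 * η ω * p ω + η ω ^ 2 * u ω - p ω ^ 2) / (1 + u ω) / 2)) ∂P
      ≤ ∫⁻ ω, Z ω ∂P := by
  have hp' : Measurable p := hp.mono hm le_rfl
  have hu' : Measurable u := hu.mono hm le_rfl
  have hZ' : Measurable Z := hZ.mono hm le_rfl
  simp_rw [← fun ω => lintegral_exp_gaussian_mixture (p ω) (η ω) (hu0 ω)]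
  have h1 : ∀ ω, Z ω * ∫⁻ g, ENNReal.ofReal (Real.exp ((p ω + √(u ω) * g) * η ω -
      (p ω + √(u ω) * g) ^ 2 / 2)) ∂(gaussianReal 0 1) =
      ∫⁻ g, Z ω * ENNReal.ofReal (Real.exp ((p ω + √(u ω) * g) * η ω -
      (p ω + √(u ω) * g) ^ 2 / 2)) ∂(gaussianReal 0 1) := fun ω =>
    (lintegral_const_mul _ (by fun_prop)).symm
  rw [lintegral_congr h1, lintegral_lintegral_swap (by fun_prop)]
  calc _ ≤ ∫⁻ _ : ℝ, ∫⁻ ω, Z ω ∂P ∂(gaussianReal 0 1) := by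
        refine lintegral_mono fun g => ?_
        refine hη.lintegral_mul_exp_le hm hηm (ξ := fun ω => p ω + √(u ω) * g) ?_ hZ
        fun_prop
    _ = ∫⁻ ω, Z ω ∂P := by simp

theorem measurableSet_forall_le_lt {Ω : Type*} {m : MeasurableSpace Ω} {M : ℕ → Ω → ℝ≥0∞}
    (c : ℝ≥0∞) {t : ℕ} (hM : ∀ s ≤ t, Measurable (M s)) :
    MeasurableSet {ω | ∀ s ≤ t, M s ω < c} := by
  simp only [Set.ofPred_forall]
  exact .iInter fun s => .iInter fun hs => measurableSet_lt (hM s hs) measurable_const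

/-- Ville's maximal inequality for a process whose one-step drift is nonpositive on every
event of the past. -/
theorem mul_measure_exists_le_of_step {M : ℕ → Ω → ℝ≥0∞} (hM : ∀ t, Measurable (M t))
    (c : ℝ≥0∞) (T : ℕ)
    (hstep : ∀ t < T, ∫⁻ ω in {ω | ∀ s ≤ t, M s ω < c}, M (t + 1) ω ∂P ≤
      ∫⁻ ω in {ω | ∀ s ≤ t, M s ω < c}, M t ω ∂P) :
    c * P {ω | ∃ t ≤ T, c ≤ M t ω} ≤ ∫⁻ ω, M 0 ω ∂P := by
  have hA : ∀ t, MeasurableSet {ω | ∀ s ≤ t, M s ω < c} := fun t =>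
    measurableSet_forall_le_lt c fun s _ => hM s
  -- A lower bound for the mean of the process stopped at level `c`: mass that has crossed counts
  -- `c`, the rest counts its current value.
  have key : ∀ t ≤ T, c * P {ω | ∃ s ≤ t, c ≤ M s ω} +
      ∫⁻ ω in {ω | ∀ s ≤ t, M s ω < c}, M t ω ∂P ≤ ∫⁻ ω, M 0 ω ∂P := by
    intro t
    induction t with
    | zero =>
      intro _
      have h1 : {ω | ∃ s ≤ 0, c ≤ M s ω} = {ω | ∀ s ≤ 0, M s ω < c}ᶜ := by
        ext ω; simp
      rw [← lintegral_add_compl (M 0) (μ := P) (hA 0), add_comm, h1]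
      refine add_le_add (α := ℝ≥0∞) le_rfl ?_
      refine (le_of_eq (setLIntegral_const _ c).symm).trans ?_
      exact setLIntegral_mono (hM 0) fun ω hω => by simpa using hω
    | succ t ih =>
      intro ht
      refine le_trans ?_ (ih (by omega))
      set A := {ω | ∀ s ≤ t, M s ω < c} with hAdef
      have hE : {ω | ∃ s ≤ t + 1, c ≤ M s ω} ⊆
          {ω | ∃ s ≤ t, c ≤ M s ω} ∪ (A ∩ {ω | c ≤ M (t + 1) ω}) := by
        rintro ω ⟨s, hs, hc⟩
        by_cases h : ∃ s ≤ t, c ≤ M s ω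
        · exact Or.inl h
        · push Not at h
          refine Or.inr ⟨h, ?_⟩
          rcases Nat.lt_or_ge t s with h' | h'
          · obtain rfl : s = t + 1 := by omega
            exact hc
          · exact absurd (h s h') (not_lt.2 hc)
      have hA' : {ω | ∀ s ≤ t + 1, M s ω < c} = A \ {ω | c ≤ M (t + 1) ω} := by
        ext ω
        simp only [hAdef, Set.mem_ofPred_eq, Set.mem_sdiff, not_le]
        constructor
        · exact fun h => ⟨fun s hs => h s (by omega), h _ le_rfl⟩
        · rintro ⟨h1, h2⟩ s hs
          rcases Nat.lt_or_ge t s with h' | h'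
          · obtain rfl : s = t + 1 := by omega
            exact h2
          · exact h1 s h'
      have hB : MeasurableSet {ω | c ≤ M (t + 1) ω} := measurableSet_le measurable_const (hM _)
      calc _ ≤ c * (P {ω | ∃ s ≤ t, c ≤ M s ω} + P (A ∩ {ω | c ≤ M (t + 1) ω})) +
            ∫⁻ ω in A \ {ω | c ≤ M (t + 1) ω}, M (t + 1) ω ∂P := by
            rw [hA']
            gcongr
            exact (measure_mono hE).trans (measure_union_le _ _)
        _ = c * P {ω | ∃ s ≤ t, c ≤ M s ω} + (c * P (A ∩ {ω | c ≤ M (t + 1) ω}) +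
            ∫⁻ ω in A \ {ω | c ≤ M (t + 1) ω}, M (t + 1) ω ∂P) := by ring
        _ ≤ c * P {ω | ∃ s ≤ t, c ≤ M s ω} + (∫⁻ ω in A ∩ {ω | c ≤ M (t + 1) ω}, M (t + 1) ω ∂P +
            ∫⁻ ω in A \ {ω | c ≤ M (t + 1) ω}, M (t + 1) ω ∂P) := by
            gcongr
            refine (le_of_eq (setLIntegral_const _ c).symm).trans ?_
            exact setLIntegral_mono (hM _) fun ω hω => hω.2
        _ = c * P {ω | ∃ s ≤ t, c ≤ M s ω} + ∫⁻ ω in A, M (t + 1) ω ∂P := by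
            rw [lintegral_inter_add_sdiff _ _ hB]
        _ ≤ _ := add_le_add le_rfl (hstep t (by omega))
  exact le_self_add.trans (key T le_rfl)

end SubGaussian

/-! ### Self-normalised concentration and confidence ellipsoids -/

section Confidence

open Matrix hiding gram
open ENNReal

variable {d : ℕ} {lam : ℝ}

/-- The Gaussian mixture `(det (λ I) / det V)^{1/2} exp (‖S‖²_{V⁻¹} / 2)`, where `V` is the
regularised Gram matrix and `S` the noise sum. -/
noncomputable def mixture (lam : ℝ) (x : ℕ → Vec d) (η : ℕ → ℝ) (t : ℕ) : ℝ :=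
  √(lam ^ d / (gram lam x t).det) *
    Real.exp (noiseSum x η t ⬝ᵥ (gram lam x t)⁻¹ *ᵥ noiseSum x η t / 2)

theorem mixture_zero (hlam : 0 < lam) (x : ℕ → Vec d) (η : ℕ → ℝ) : mixture lam x η 0 = 1 := by
  simp [mixture, noiseSum, gram_zero, hlam.ne']

theorem mixture_pos (hlam : 0 < lam) (x : ℕ → Vec d) (η : ℕ → ℝ) (t : ℕ) :
    0 < mixture lam x η t := by
  have := (gram_posDef hlam x t).det_pos
  unfold mixture
  positivity

/-- The new factor is the scalar Gaussian mixture with mean `xᵀ V⁻¹ S` and variance `xᵀ V⁻¹ x`, both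
determined before the noise of round `t`. -/
theorem mixture_succ (hlam : 0 < lam) (x : ℕ → Vec d) (η : ℕ → ℝ) (t : ℕ) :
    mixture lam x η (t + 1) = mixture lam x η t *
      ((√(1 + (x t).ofLp ⬝ᵥ (gram lam x t)⁻¹ *ᵥ (x t).ofLp))⁻¹ *
        Real.exp ((2 * η t * ((x t).ofLp ⬝ᵥ (gram lam x t)⁻¹ *ᵥ noiseSum x η t) +
          η t ^ 2 * ((x t).ofLp ⬝ᵥ (gram lam x t)⁻¹ *ᵥ (x t).ofLp) -
          ((x t).ofLp ⬝ᵥ (gram lam x t)⁻¹ *ᵥ noiseSum x η t) ^ 2) /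
          (1 + (x t).ofLp ⬝ᵥ (gram lam x t)⁻¹ *ᵥ (x t).ofLp) / 2)) := by
  have hV := gram_posDef hlam x t
  have hS : noiseSum x η (t + 1) = noiseSum x η t + η t • (x t).ofLp := by
    simp [noiseSum, Finset.sum_range_succ]
  have hdet := hV.det_pos
  rw [mixture, mixture, hS, gram_succ, hV.inv_quadratic_rank_one_update,
    hV.det_add_vecMulVec_self, add_div, Real.exp_add, ← div_div,
    Real.sqrt_div (by positivity), div_eq_mul_inv]
  ring

theorem log_mixture (hlam : 0 < lam) (x : ℕ → Vec d) (η : ℕ → ℝ) (t : ℕ) :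
    Real.log (mixture lam x η t) = (d * Real.log lam - Real.log (gram lam x t).det) / 2 +
      noiseSum x η t ⬝ᵥ (gram lam x t)⁻¹ *ᵥ noiseSum x η t / 2 := by
  have hdet := (gram_posDef hlam x t).det_pos
  rw [mixture, Real.log_mul (by positivity) (Real.exp_pos _).ne', Real.log_exp,
    Real.log_sqrt (by positivity), Real.log_div (by positivity) hdet.ne', Real.log_pow]

theorem confRadius_eq (hlam : 0 < lam) (U : ℕ) {δ : ℝ} (hδ : 0 < δ) (x : ℕ → Vec d) (t : ℕ) :
    confRadius U lam δ x t = √(2 * Real.log (((U : ℝ) + 1) / δ) +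
      (Real.log (gram lam x t).det - d * Real.log lam)) + √lam := by
  have hdet := (gram_posDef hlam x t).det_pos
  have hU : (0 : ℝ) < U + 1 := by positivity
  have hl : 0 < lam ^ d := by positivity
  rw [confRadius, det_smul_one, Real.log_div (by positivity) hδ.ne',
    Real.log_mul (by positivity) (by positivity), Real.log_mul (by positivity) (by positivity),
    Real.log_rpow hdet, Real.log_rpow hl, Real.log_pow, Real.log_div hU.ne' hδ.ne']
  congr 2
  ring

/-- The ridge ellipsoid contains the true parameter as long as the mixture stays below
`(U + 1) / δ`. -/
theorem mem_confEllipsoid_of_mixture_lt (hlam : 0 < lam) (U : ℕ) {δ : ℝ} (hδ : 0 < δ)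
    (x : ℕ → Vec d) (y : ℕ → ℝ) (v : Vec d) (hv : ‖v‖ ≤ 1) (t : ℕ)
    (h : mixture lam x (fun τ => y τ - inner ℝ v (x τ)) t < ((U : ℝ) + 1) / δ) :
    v ∈ confEllipsoid U lam δ x y t := by
  refine (weightedNorm_sub_ridge_le hlam x y v hv t).trans ?_
  rw [confRadius_eq hlam U hδ]
  gcongr
  have := Real.log_le_log (mixture_pos hlam x _ t) h.le
  rw [log_mixture hlam] at this
  linarith

section Measurability

variable {Ω n : Type*} {m : MeasurableSpace Ω} [Fintype n] [DecidableEq n]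

theorem Measurable.matrix_det {A : Ω → Matrix n n ℝ} (hA : ∀ i j, Measurable fun ω => A ω i j) :
    Measurable fun ω => (A ω).det := by
  simp only [Matrix.det_apply]
  fun_prop

theorem Measurable.matrix_inv_apply {A : Ω → Matrix n n ℝ}
    (hA : ∀ i j, Measurable fun ω => A ω i j) (i j : n) : Measurable fun ω => (A ω)⁻¹ i j := by
  have hdet := Measurable.matrix_det hA
  have hadj : Measurable fun ω => (A ω).adjugate i j := by
    simp only [Matrix.adjugate_apply]
    refine Measurable.matrix_det fun k l => ?_
    simp only [Matrix.updateRow_apply]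
    split_ifs
    · exact measurable_const
    · exact hA k l
  simp only [Matrix.inv_def, Matrix.smul_apply, Ring.inverse_eq_inv', smul_eq_mul]
  fun_prop

theorem Measurable.inv_quadratic {A : Ω → Matrix n n ℝ} {a b : Ω → n → ℝ}
    (hA : ∀ i j, Measurable fun ω => A ω i j) (ha : ∀ i, Measurable fun ω => a ω i)
    (hb : ∀ i, Measurable fun ω => b ω i) :
    Measurable fun ω => a ω ⬝ᵥ (A ω)⁻¹ *ᵥ b ω := by
  simp only [dotProduct, mulVec]
  exact Finset.measurable_sum _ fun i _ => (ha i).mul (Finset.measurable_sum _ fun j _ =>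
    (Measurable.matrix_inv_apply hA i j).mul (hb j))

end Measurability

variable {Ω : Type*}

theorem measurable_gram_apply {m : MeasurableSpace Ω} {x : ℕ → Ω → Vec d} {t : ℕ}
    (hx : ∀ τ < t, Measurable (x τ)) (i j : Fin d) :
    Measurable fun ω => gram lam (fun τ => x τ ω) t i j := by
  simp only [gram, Matrix.add_apply, Matrix.sum_apply, vecMulVec_apply]
  refine measurable_const.add (Finset.measurable_sum _ fun τ hτ => ?_)
  have := hx τ (Finset.mem_range.1 hτ)
  fun_prop

theorem measurable_noiseSum_apply {m : MeasurableSpace Ω} {x : ℕ → Ω → Vec d} {η : ℕ → Ω → ℝ}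
    {t : ℕ} (hx : ∀ τ < t, Measurable (x τ)) (hη : ∀ τ < t, Measurable (η τ)) (i : Fin d) :
    Measurable fun ω => noiseSum (fun τ => x τ ω) (fun τ => η τ ω) t i := by
  simp only [noiseSum, Finset.sum_apply, Pi.smul_apply, smul_eq_mul]
  refine Finset.measurable_sum _ fun τ hτ => ?_
  have := hx τ (Finset.mem_range.1 hτ)
  have := hη τ (Finset.mem_range.1 hτ)
  fun_prop

theorem measurable_mixture {m : MeasurableSpace Ω} {x : ℕ → Ω → Vec d} {η : ℕ → Ω → ℝ}
    {t : ℕ} (hx : ∀ τ < t, Measurable (x τ)) (hη : ∀ τ < t, Measurable (η τ)) :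
    Measurable fun ω => mixture lam (fun τ => x τ ω) (fun τ => η τ ω) t := by
  have h1 := Measurable.matrix_det (measurable_gram_apply (lam := lam) hx)
  have h2 := Measurable.inv_quadratic (measurable_gram_apply (lam := lam) hx)
    (measurable_noiseSum_apply hx hη) (measurable_noiseSum_apply hx hη)
  unfold mixture
  fun_prop

variable {mΩ : MeasurableSpace Ω} {P : Measure Ω} [IsProbabilityMeasure P]

/-- The self-normalised maximal inequality. -/
theorem mul_measure_exists_le_mixture_le (hlam : 0 < lam) {F : ℕ → MeasurableSpace Ω}
    (hF : ∀ t, F t ≤ mΩ) {x : ℕ → Ω → Vec d} {η : ℕ → Ω → ℝ}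
    (hx : ∀ t, ∀ τ ≤ t, Measurable[F t] (x τ)) (hη : ∀ t, ∀ τ < t, Measurable[F t] (η τ))
    (T : ℕ) (hsub : ∀ t < T, CondOneSubGaussian P (F t) (η t)) (c : ℝ≥0∞) :
    c * P {ω | ∃ t ≤ T,
      c ≤ ENNReal.ofReal (mixture lam (fun τ => x τ ω) (fun τ => η τ ω) t)} ≤ 1 := by
  have hx' : ∀ τ, Measurable (x τ) := fun τ => (hx τ τ le_rfl).mono (hF τ) le_rfl
  have hη' : ∀ τ, Measurable (η τ) := fun τ =>
    (hη (τ + 1) τ (Nat.lt_succ_self τ)).mono (hF _) le_rfl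
  have hMF : ∀ t s, s ≤ t → Measurable[F t] fun ω =>
      ENNReal.ofReal (mixture lam (fun τ => x τ ω) (fun τ => η τ ω) s) := fun t s hs =>
    (measurable_mixture (fun τ hτ => hx t τ (by omega))
      (fun τ hτ => hη t τ (by omega))).ennreal_ofReal
  refine (mul_measure_exists_le_of_step (P := P) (fun t => (hMF t t le_rfl).mono (hF t) le_rfl)
    c T fun t ht => ?_).trans_eq (by simp [mixture_zero hlam])
  set A := {ω | ∀ s ≤ t,
    ENNReal.ofReal (mixture lam (fun τ => x τ ω) (fun τ => η τ ω) s) < c} with hA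
  have hAm : MeasurableSet[F t] A :=
    measurableSet_forall_le_lt (m := F t) c (hMF t)
  have hAm' : MeasurableSet A := hF t A hAm
  rw [← lintegral_indicator hAm', ← lintegral_indicator hAm']
  have hg := measurable_gram_apply (lam := lam) (m := F t) fun τ (hτ : τ < t) => hx t τ hτ.le
  have hxt : ∀ i, Measurable[F t] fun ω => (x t ω).ofLp i := fun i => by
    have := hx t t le_rfl
    fun_prop
  have hn := measurable_noiseSum_apply (m := F t) (fun τ (hτ : τ < t) => hx t τ hτ.le) (hη t)
  -- The event `A` belongs to the past, so its indicator joins the current mixture as the weight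
  -- `Z`.
  refine le_trans (le_of_eq (lintegral_congr fun ω => ?_))
    ((hsub t ht).lintegral_mul_mixture_le (hF t) (hη' t)
      (Measurable.inv_quadratic hg hxt hn) (Measurable.inv_quadratic hg hxt hxt)
      (fun ω => (gram_posDef hlam _ t).inv_quadratic_nonneg _)
      ((hMF t t le_rfl).indicator hAm))
  by_cases hω : ω ∈ A
  · rw [Set.indicator_of_mem hω, Set.indicator_of_mem hω, mixture_succ hlam,
      ENNReal.ofReal_mul (mixture_pos hlam _ _ t).le]
  · rw [Set.indicator_of_notMem hω, Set.indicator_of_notMem hω, zero_mul]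

/-- Validity of the confidence ellipsoids, uniformly over the rounds. -/
theorem measure_exists_notMem_confEllipsoid_le (hlam : 0 < lam) (U : ℕ) {δ : ℝ} (hδ : 0 < δ)
    {F : ℕ → MeasurableSpace Ω} (hF : ∀ t, F t ≤ mΩ) {x : ℕ → Ω → Vec d} {y : ℕ → Ω → ℝ}
    (hx : ∀ t, ∀ τ ≤ t, Measurable[F t] (x τ)) (hy : ∀ t, ∀ τ < t, Measurable[F t] (y τ))
    {v : Vec d} (hv : ‖v‖ ≤ 1) (T : ℕ)
    (hsub : ∀ t < T, CondOneSubGaussian P (F t) fun ω => y t ω - inner ℝ v (x t ω)) :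
    P {ω | ∃ t ≤ T, v ∉ confEllipsoid U lam δ (fun τ => x τ ω) (fun τ => y τ ω) t} ≤
      ENNReal.ofReal (δ / (U + 1)) := by
  have hc : 0 < ((U : ℝ) + 1) / δ := by positivity
  have h := mul_measure_exists_le_mixture_le hlam hF hx (P := P)
    (η := fun t ω => y t ω - inner ℝ v (x t ω)) (fun t τ hτ => by
      have := hy t τ hτ
      have := hx t τ hτ.le
      fun_prop) T hsub (ENNReal.ofReal (((U : ℝ) + 1) / δ))
  rw [← inv_div, ENNReal.ofReal_inv_of_pos hc]
  refine (measure_mono ?_).trans (ENNReal.le_inv_iff_mul_le.2 (by rwa [mul_comm]))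
  rintro ω ⟨t, ht, hω⟩
  refine ⟨t, ht, ENNReal.ofReal_le_ofReal (not_lt.1 fun hlt => hω ?_)⟩
  exact mem_confEllipsoid_of_mixture_lt hlam U hδ _ _ v hv t hlt

end Confidence

/-! ### Optimism and the deterministic regret bound -/

section Regret

open Matrix hiding gram

variable {d K U : ℕ} {lam δ : ℝ}

theorem inner_sub_le_of_mem_confEllipsoid (hlam : 0 < lam) {x : ℕ → Vec d} {y : ℕ → ℝ} {t : ℕ}
    {v w : Vec d} (hv : v ∈ confEllipsoid U lam δ x y t) (hw : w ∈ confEllipsoid U lam δ x y t)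
    (z : Vec d) :
    inner ℝ (v - w) z ≤
      2 * confRadius U lam δ x t * √(z.ofLp ⬝ᵥ (gram lam x t)⁻¹ *ᵥ z.ofLp) := by
  have hV := gram_posDef hlam x t
  rw [confEllipsoid, Set.mem_ofPred_eq, weightedNorm_eq] at hv hw
  rw [inner_eq_dotProduct]
  refine (hV.dotProduct_le_sqrt_mul_sqrt _ _).trans ?_
  gcongr
  have hsub : (v - w).ofLp = (v - ridge lam x y t).ofLp + -(w - ridge lam x y t).ofLp := by
    simp only [WithLp.ofLp_sub]; abel
  rw [hsub]
  refine (hV.posSemidef.sqrt_dotProduct_mulVec_add_le _ _).trans ?_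
  simp only [mulVec_neg, dotProduct_neg, neg_dotProduct, neg_neg]
  linarith

/-- For `y = (g / 2b)²` one has `y ≤ u²`, and `g ≤ 2` gives `b² y ≤ 1`. Hence `b² y ≤ (b² + 1) y /
(1 + y)`, and `y / (1 + y) ≤ log (1 + y)`. The cap on `g` replaces any bound on `u`. -/
theorem sq_le_mul_log_one_add_sq {g b u : ℝ} (hg : 0 ≤ g) (hb : 0 < b) (h2 : g ≤ 2)
    (hgu : g ≤ 2 * b * u) : g ^ 2 ≤ 4 * (b ^ 2 + 1) * Real.log (1 + u ^ 2) := by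
  set y := (g / (2 * b)) ^ 2 with hy
  have hy0 : 0 ≤ y := by positivity
  have hg2 : g ^ 2 = 4 * b ^ 2 * y := by rw [hy]; field_simp; ring
  have hyu : y ≤ u ^ 2 := by
    refine pow_le_pow_left₀ (by positivity) ?_ 2
    rwa [div_le_iff₀ (by positivity), mul_comm]
  have hyb : b ^ 2 * y ≤ 1 := by nlinarith
  have h1 := Real.one_sub_inv_le_log_of_pos (show 0 < 1 + y by positivity)
  have h3 : Real.log (1 + y) ≤ Real.log (1 + u ^ 2) :=
    Real.log_le_log (by positivity) (by linarith)
  have h4 : b ^ 2 * y ≤ (b ^ 2 + 1) * (1 - (1 + y)⁻¹) := by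
    rw [show 1 - (1 + y)⁻¹ = y / (1 + y) by field_simp; ring, ← mul_div_assoc,
      le_div_iff₀ (by positivity)]
    nlinarith
  have h5 : (b ^ 2 + 1) * (1 - (1 + y)⁻¹) ≤ (b ^ 2 + 1) * Real.log (1 + u ^ 2) := by
    gcongr
    exact h1.trans h3
  rw [hg2]
  linarith

theorem inner_sub_le_two {a y z : Vec d} (ha : ‖a‖ ≤ 1) (hy : ‖y‖ ≤ 1) (hz : ‖z‖ ≤ 1) :
    inner ℝ a (y - z) ≤ (2 : ℝ) := by
  have h1 := real_inner_le_norm a (y - z)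
  have h2 := norm_sub_le y z
  nlinarith [norm_nonneg (y - z), norm_nonneg a]

namespace SafeBandit

variable {B : SafeBandit d K U}

theorem violation_nonneg (B : SafeBandit d K U) (z : Vec d) : 0 ≤ B.violation z :=
  Real.iSup_nonneg fun _ => le_max_right _ _

theorem violation_le {z : Vec d} (hz : z ∈ B.knownDomain) {c : ℝ} (hc : 0 ≤ c)
    (h : ∀ i, inner ℝ (B.a (Sum.inr i)) z - B.α (Sum.inr i) ≤ c) : B.violation z ≤ c := by
  refine Real.iSup_le (fun i => max_le ?_ hc) hc
  rcases i with i | i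
  · exact (sub_nonpos.2 (hz.2 i)).trans hc
  · exact h i

theorem instantaneous_regret_le_two {xs : Vec d} (hxs : xs ∈ B.feasible)
    (hX : ∀ x ∈ B.X, ‖x‖ ≤ 1) (hθ : ‖B.θ‖ ≤ 1) (ha : ∀ i, ‖B.a i‖ ≤ 1) {z : Vec d}
    (hz : z ∈ B.knownDomain) : max (inner ℝ B.θ (xs - z)) (B.violation z) ≤ 2 := by
  have h1 := hX xs hxs.1.1
  have h2 := hX z hz.1
  refine max_le (inner_sub_le_two hθ h1 h2) (violation_le hz zero_le_two fun i => ?_)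
  have h3 := inner_sub_le_two (ha (Sum.inr i)) h2 h1
  have h4 := hxs.2 i
  rw [inner_sub_right] at h3
  linarith

theorem mem_permissible_of_feasible {xs : Vec d} (hxs : xs ∈ B.feasible) {x : ℕ → Vec d}
    {s : Fin K ⊕ Fin U → ℕ → ℝ} {t : ℕ}
    (ha : ∀ i, B.a (Sum.inr i) ∈ confEllipsoid U lam δ x (s (Sum.inr i)) t) :
    xs ∈ B.permissible lam δ x s t := by
  refine ⟨hxs.1, fun i => ⟨B.a i, ?_, ?_⟩⟩
  · rcases i with i | i
    · exact rfl
    · exact ha i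
  · rcases i with i | i
    · exact hxs.1.2 i
    · exact hxs.2 i

theorem confRadius_nonneg (U : ℕ) (lam δ : ℝ) (x : ℕ → Vec d) (t : ℕ) :
    0 ≤ confRadius U lam δ x t := by
  unfold confRadius
  positivity

/-- Optimism gives `⟪θ, xs⟫ ≤ ⟪v, x_t⟫`, so the objective gap is at most `⟪v - θ, x_t⟫`.
Permissibility gives `w` with `⟪w, x_t⟫ ≤ α`, so the violation is at most `⟪a - w, x_t⟫`. Both
compare two points of one ellipsoid. -/
theorem instantaneous_regret_le (hlam : 0 < lam) {xs : Vec d} (hxs : xs ∈ B.feasible)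
    {x : ℕ → Vec d} {r : ℕ → ℝ} {s : Fin K ⊕ Fin U → ℕ → ℝ} {t : ℕ}
    (hstep : B.IsDOSLBStep lam δ x r s t) (hθ : B.θ ∈ confEllipsoid U lam δ x r t)
    (ha : ∀ i, B.a (Sum.inr i) ∈ confEllipsoid U lam δ x (s (Sum.inr i)) t) :
    max (inner ℝ B.θ (xs - x t)) (B.violation (x t)) ≤
      2 * confRadius U lam δ x t * √((x t).ofLp ⬝ᵥ (gram lam x t)⁻¹ *ᵥ (x t).ofLp) := by
  have hperm := mem_permissible_of_feasible hxs ha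
  obtain ⟨hx, v, hv, hmax⟩ := hstep.2 ⟨xs, hperm⟩
  have hr := confRadius_nonneg U lam δ x t
  refine max_le ?_ (violation_le hstep.1 (by positivity) fun i => ?_)
  · have h1 := hmax xs hperm B.θ hθ
    have h2 := inner_sub_le_of_mem_confEllipsoid hlam hv hθ (x t)
    rw [inner_sub_left] at h2
    rw [inner_sub_right]
    linarith
  · obtain ⟨w, hw, hwα⟩ := hx.2 (Sum.inr i)
    have h2 := inner_sub_le_of_mem_confEllipsoid hlam (ha i) hw (x t)
    rw [inner_sub_left] at h2
    linarith

theorem regret_le_regretBound (hlam : 1 ≤ lam) (hδ : 0 < δ) (hδ1 : δ ≤ 1) {xs : Vec d}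
    (hxs : xs ∈ B.feasible) (hX : ∀ x ∈ B.X, ‖x‖ ≤ 1) (hθ : ‖B.θ‖ ≤ 1) (ha : ∀ i, ‖B.a i‖ ≤ 1)
    {x : ℕ → Vec d} {r : ℕ → ℝ} {s : Fin K ⊕ Fin U → ℕ → ℝ} {T : ℕ}
    (hstep : ∀ t < T, B.IsDOSLBStep lam δ x r s t)
    (hθm : ∀ t < T, B.θ ∈ confEllipsoid U lam δ x r t)
    (ham : ∀ t < T, ∀ i, B.a (Sum.inr i) ∈ confEllipsoid U lam δ x (s (Sum.inr i)) t) :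
    B.regret xs x T ≤ regretBound d U T lam δ := by
  have hlam0 : 0 < lam := by linarith
  have hx1 : ∀ t < T, ‖x t‖ ≤ 1 := fun t ht => hX _ (hstep t ht).1.1
  set L : ℝ := d * Real.log (1 + T / (lam * d)) with hL
  have hL0 : 0 ≤ L :=
    mul_nonneg d.cast_nonneg (Real.log_nonneg (le_add_of_nonneg_right (by positivity)))
  set W := Real.log (((U : ℝ) + 1) / δ) with hW
  have hW0 : 0 ≤ W := Real.log_nonneg (by
    rw [le_div_iff₀ hδ]
    have : (0 : ℝ) ≤ U := U.cast_nonneg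
    linarith)
  set Q := √(1 / 2 * W + d / 4 * Real.log (1 + T / (lam * d))) with hQ
  have hQ0 : 0 ≤ Q := Real.sqrt_nonneg _
  have hl1 : 1 ≤ √lam := Real.one_le_sqrt.2 hlam
  have hQ2 : √(2 * W + L) = 2 * Q := by
    rw [show 2 * W + L = 2 ^ 2 * (1 / 2 * W + d / 4 * Real.log (1 + T / (lam * d))) by
      rw [hL]; ring, Real.sqrt_mul (by norm_num), Real.sqrt_sq (by norm_num)]
  set b := 2 * Q + √lam with hb
  have hb0 : 0 < b := by positivity
  have hrad : ∀ t < T, confRadius U lam δ x t ≤ b := by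
    intro t ht
    rw [confRadius_eq hlam0 U hδ, hb, ← hQ2, ← hW]
    gcongr
    refine (log_det_gram_le hlam0 x t fun τ hτ => hx1 τ (hτ.trans ht)).trans ?_
    rw [hL]
    gcongr
  have hround : ∀ t ∈ Finset.range T, (max (inner ℝ B.θ (xs - x t)) (B.violation (x t))) ^ 2 ≤
      4 * (b ^ 2 + 1) * Real.log (1 + (x t).ofLp ⬝ᵥ (gram lam x t)⁻¹ *ᵥ (x t).ofLp) := by
    intro t ht
    have ht := Finset.mem_range.1 ht
    have h1 := sq_le_mul_log_one_add_sq ((B.violation_nonneg (x t)).trans (le_max_right _ _)) hb0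
      (instantaneous_regret_le_two hxs hX hθ ha (hstep t ht).1)
      ((instantaneous_regret_le hlam0 hxs (hstep t ht) (hθm t ht) (ham t ht)).trans (by
        gcongr
        exact hrad t ht))
    rwa [Real.sq_sqrt ((gram_posDef hlam0 x t).inv_quadratic_nonneg _)] at h1
  have hsq : B.regret xs x T ^ 2 ≤ T * (4 * (b ^ 2 + 1) * L) := by
    have h1 := sq_sum_le_card_mul_sum_sq (s := Finset.range T)
      (f := fun t => max (inner ℝ B.θ (xs - x t)) (B.violation (x t)))
    rw [Finset.card_range] at h1
    refine h1.trans ?_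
    gcongr
    refine (Finset.sum_le_sum hround).trans ?_
    rw [← Finset.mul_sum, ← log_det_gram_eq_sum hlam0]
    gcongr
    exact log_det_gram_le hlam0 x T hx1
  refine le_of_sq_le_sq ?_ (by unfold regretBound; positivity)
  refine hsq.trans ?_
  rw [regretBound, ← hW, ← hQ, mul_pow, mul_pow, mul_assoc (T : ℝ), ← hL,
    Real.sq_sqrt (by positivity)]
  -- Here `λ ≥ 1` absorbs the `+ 1`.
  have hfac : 4 * (b ^ 2 + 1) ≤ 16 * (√lam + Q) ^ 2 := by
    rw [hb]
    nlinarith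
  have := mul_le_mul_of_nonneg_left hfac (show 0 ≤ T * L by positivity)
  nlinarith

end SafeBandit

/-- The quantity `G = 1 + log (1 + T) + log ((U + 1) / δ)` is at least `1` and dominates both
logarithms, so each of the two factors contributes one `√d √G`. -/
theorem regretBound_le (hlam : 1 ≤ lam) (d U T : ℕ) {δ : ℝ} (hd : 1 ≤ d) (hδ : 0 < δ)
    (hδ1 : δ < 1) :
    regretBound d U T lam δ ≤ 4 * (√lam + 1) * (d * √T) *
      (1 + Real.log (1 + T) + Real.log (((U : ℝ) + 1) / δ)) := by
  have hd' : (1 : ℝ) ≤ d := by exact_mod_cast hd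
  have hT : (0 : ℝ) ≤ T := T.cast_nonneg
  have hW0 : 0 ≤ Real.log (((U : ℝ) + 1) / δ) := Real.log_nonneg (by
    rw [le_div_iff₀ hδ]
    have : (0 : ℝ) ≤ U := U.cast_nonneg
    linarith)
  have hL0 : 0 ≤ Real.log (1 + (T : ℝ) / (lam * d)) :=
    Real.log_nonneg (le_add_of_nonneg_right (by positivity))
  have hLl : Real.log (1 + (T : ℝ) / (lam * d)) ≤ Real.log (1 + T) := by
    refine Real.log_le_log (by positivity) ?_
    gcongr
    exact div_le_self hT (by nlinarith)
  unfold regretBound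
  set W := Real.log (((U : ℝ) + 1) / δ)
  set L := Real.log (1 + (T : ℝ) / (lam * d))
  set l := Real.log (1 + (T : ℝ))
  set G := 1 + l + W with hG
  have hG1 : 1 ≤ √G := Real.one_le_sqrt.2 (by linarith)
  have hGs : √G * √G = G := Real.mul_self_sqrt (by linarith)
  have h1 : √(T * d * L) ≤ √T * √d * √G := by
    rw [← Real.sqrt_mul hT, ← Real.sqrt_mul (by positivity)]
    gcongr
    linarith
  have h2 : √(1 / 2 * W + d / 4 * L) ≤ √d * √G := by
    rw [← Real.sqrt_mul (by positivity)]
    refine Real.sqrt_le_sqrt ?_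
    nlinarith
  have hd1 : 1 ≤ √(d : ℝ) := Real.one_le_sqrt.2 hd'
  have h3 : √lam ≤ √lam * (√d * √G) :=
    le_mul_of_one_le_right (Real.sqrt_nonneg _) (by nlinarith)
  calc 4 * √(T * d * L) * (√lam + √(1 / 2 * W + d / 4 * L))
      ≤ 4 * (√T * √d * √G) * (√lam * (√d * √G) + √d * √G) := by gcongr
    _ = 4 * (√lam + 1) * ((√d * √d) * √T) * (√G * √G) := by ring
    _ = _ := by rw [hGs, Real.mul_self_sqrt (by positivity)]

end Regret

/-! ### Measurability with respect to the information σ-algebra -/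

section Information

variable {Ω ι : Type*} {d : ℕ} {x : ℕ → Ω → Vec d} {r : ℕ → Ω → ℝ} {s : ι → ℕ → Ω → ℝ}

theorem infoSigma_le [mΩ : MeasurableSpace Ω] (hx : ∀ t, Measurable (x t))
    (hr : ∀ t, Measurable (r t)) (hs : ∀ i t, Measurable (s i t)) (t : ℕ) :
    infoSigma x r s t ≤ mΩ :=
  sup_le (iSup₂_le fun τ _ => sup_le (sup_le (hx τ).comap_le (hr τ).comap_le)
    (iSup_le fun i => (hs i τ).comap_le)) (hx t).comap_le

theorem comap_le_infoSigma {τ t : ℕ} (h : τ < t) :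
    (MeasurableSpace.comap (x τ) inferInstance ⊔ MeasurableSpace.comap (r τ) inferInstance ⊔
      ⨆ i, MeasurableSpace.comap (s i τ) inferInstance) ≤ infoSigma x r s t :=
  le_sup_of_le_left (le_iSup₂_of_le τ h le_rfl)

theorem measurable_action_infoSigma (t : ℕ) :
    ∀ τ ≤ t, Measurable[infoSigma x r s t] (x τ) := by
  intro τ hτ
  rw [measurable_iff_comap_le]
  rcases hτ.eq_or_lt with rfl | h
  · exact le_sup_right
  · exact (le_sup_left.trans le_sup_left).trans (comap_le_infoSigma h)

theorem measurable_reward_infoSigma (t : ℕ) :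
    ∀ τ < t, Measurable[infoSigma x r s t] (r τ) := fun _ h =>
  measurable_iff_comap_le.2 ((le_sup_right.trans le_sup_left).trans (comap_le_infoSigma h))

theorem measurable_safety_infoSigma (i : ι) (t : ℕ) :
    ∀ τ < t, Measurable[infoSigma x r s t] (s i τ) := fun τ h =>
  measurable_iff_comap_le.2 (((le_iSup (fun i => MeasurableSpace.comap (s i τ) inferInstance)
    i).trans le_sup_right).trans (comap_le_infoSigma h))

end Information

theorem mainTheorem1
    {d K U : ℕ} (B : SafeBandit d K U) (xs : Vec d) (hxs : B.IsOptimal xs)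
    (hX : ∀ x ∈ B.X, ‖x‖ ≤ 1) (hθ : ‖B.θ‖ ≤ 1) (ha : ∀ i, ‖B.a i‖ ≤ 1)
    (lam δ : ℝ) (hlam : 1 ≤ lam) (hδ : 0 < δ) (T : ℕ)
    {Ω : Type*} [MeasurableSpace Ω] (P : Measure Ω) [IsProbabilityMeasure P]
    (x : ℕ → Ω → Vec d) (r : ℕ → Ω → ℝ) (s : Fin K ⊕ Fin U → ℕ → Ω → ℝ)
    (hx : ∀ t, Measurable (x t)) (hr : ∀ t, Measurable (r t)) (hs : ∀ i t, Measurable (s i t))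
    (hreward : ∀ t < T, CondOneSubGaussian P (infoSigma x r s t)
      (fun ω => r t ω - inner ℝ B.θ (x t ω)))
    (hsafety : ∀ i, ∀ t < T, CondOneSubGaussian P (infoSigma x r s t)
      (fun ω => s i t ω - inner ℝ (B.a i) (x t ω)))
    (hplay : ∀ᵐ ω ∂P, ∀ t < T,
      B.IsDOSLBStep lam δ (fun τ => x τ ω) (fun τ => r τ ω) (fun i τ => s i τ ω) t) :
    1 - δ ≤ P.real {ω | B.regret xs (fun t => x t ω) T ≤ regretBound d U T lam δ} ∧
      ∃ C : ℝ, 0 < C ∧ ∀ (d' U' T' : ℕ) (δ' : ℝ), 1 ≤ d' → 0 < δ' → δ' < 1 →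
        regretBound d' U' T' lam δ' ≤
          C * (d' * √T') * (1 + Real.log (1 + T') + Real.log (((U' : ℝ) + 1) / δ')) := by

  have hlam0 : 0 < lam := by linarith
  refine ⟨?_, 4 * (√lam + 1), by positivity, fun d' U' T' δ' hd' hδ' hδ1' =>
    regretBound_le hlam d' U' T' hd' hδ' hδ1'⟩
  -- For `δ ≥ 1` the probability claim is vacuous; below `1`, `log ((U + 1) / δ)` is nonnegative, as
  -- the regret bound requires.
  rcases le_or_gt 1 δ with h1 | hδ1
  · exact (sub_nonpos.2 h1).trans measureReal_nonneg
  set G := {ω | B.regret xs (fun t => x t ω) T ≤ regretBound d U T lam δ} with hG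
  set bad : Vec d → (ℕ → Ω → ℝ) → Set Ω := fun v y =>
    {ω | ∃ t ≤ T, v ∉ confEllipsoid U lam δ (fun τ => x τ ω) (fun τ => y τ ω) t} with hbad
  have hF := infoSigma_le hx hr hs
  have hθbad : P (bad B.θ r) ≤ ENNReal.ofReal (δ / (U + 1)) :=
    measure_exists_notMem_confEllipsoid_le hlam0 U hδ hF measurable_action_infoSigma
      measurable_reward_infoSigma hθ T hreward
  have habad : ∀ i, P (bad (B.a i) (s i)) ≤ ENNReal.ofReal (δ / (U + 1)) := fun i =>
    measure_exists_notMem_confEllipsoid_le hlam0 U hδ hF measurable_action_infoSigma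
      (measurable_safety_infoSigma i) (ha i) T (hsafety i)
  -- Known constraints have singleton confidence sets, which cannot fail: only `U + 1` events share
  -- the budget `δ`.
  set E := bad B.θ r ∪ ⋃ i : Fin U, bad (B.a (Sum.inr i)) (s (Sum.inr i)) with hE
  have hEP : P E ≤ ENNReal.ofReal δ := by
    calc P E ≤ P (bad B.θ r) + ∑ i : Fin U, P (bad (B.a (Sum.inr i)) (s (Sum.inr i))) :=
          (measure_union_le _ _).trans (add_le_add le_rfl (measure_iUnion_fintype_le _ _))
      _ ≤ ENNReal.ofReal (δ / (U + 1)) + ∑ _i : Fin U, ENNReal.ofReal (δ / (U + 1)) :=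
          add_le_add hθbad (Finset.sum_le_sum fun i _ => habad _)
      _ = ENNReal.ofReal δ := by
          rw [Finset.sum_const, Finset.card_univ, Fintype.card_fin, ← succ_nsmul',
            ← ENNReal.ofReal_nsmul]
          congr 1
          rw [nsmul_eq_mul]
          push_cast
          field_simp
  have hcover : ∀ᵐ ω ∂P, ω ∈ (Set.univ : Set Ω) → ω ∈ G ∪ E := by
    filter_upwards [hplay] with ω hω _
    by_cases hωE : ω ∈ E
    · exact Or.inr hωE
    · simp only [hE, hbad, Set.mem_union, Set.mem_iUnion, Set.mem_ofPred_eq, not_or, not_exists,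
        not_and, not_not] at hωE
      exact Or.inl (SafeBandit.regret_le_regretBound hlam hδ hδ1.le hxs.1 hX hθ ha hω
        (fun t ht => hωE.1 t ht.le) (fun t ht i => hωE.2 i t ht.le))
  -- Subadditivity of the outer measure suffices, so measurability of `G` and `E` is not required.
  have h1 : 1 ≤ P.real G + P.real E := by
    have h2 : P.real Set.univ ≤ P.real (G ∪ E) :=
      ENNReal.toReal_mono (measure_ne_top _ _) (measure_mono_ae hcover)
    rw [probReal_univ] at h2
    exact h2.trans (measureReal_union_le _ _)
  have h2 : P.real E ≤ δ := ENNReal.toReal_le_of_le_ofReal hδ.le hEP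
  linarith
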